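/- Let $K$ be a global field (a number field, or a finite extension of the rational function field $\mathbb{F}_q(t)$ over a finite field $\mathbb{F}_q$), let $r\ge 1$, and let $a_1,\dots,a_r\in K$ (not necessarily distinct). The following three conditions are equivalent. 1. There exist a finite Galois extension $L/K$ and nonzero elements $\theta_1,\dots,\theta_r\in L$, any two of which are conjugate under $\mathrm{Gal}(L/K)$ (repetitions allowed), such that $\sum_{i=1}^r a_i\theta_i=0$. 2. There exists a probability distribution $(X_1,\dots,X_r)$ on $K^r$, different from the point mass at the origin, which is supported on a finite subset of the hyperplane $\{x\in K^r:\sum_{i=1}^r a_ix_i=0\}$ and whose marginals $X_1,\dots,X_r$ are all equal in distribution. 3. There exist an integer $N\ge 1$ and $N\times N$ permutation matrices $\Pi_1,\dots,\Pi_r$ (repetitions allowed) such that $\det\left(\sum_{i=1}^r a_i\Pi_i\right)=0$. -/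

import Mathlib

/-- A global field: a number field, or a finite extension of the rational function field
`F(t)` over some finite field `F`. -/
def IsGlobalField (K : Type*) [Field K] : Prop :=
  NumberField K ∨
    ∃ (F : Type) (_ : Field F) (_ : Finite F) (_ : Algebra (RatFunc F) K), FunctionField F K

/-- Some finite Galois extension `L` of `K` contains nonzero elements `θ 0, …, θ (r - 1)`, any two
of which are conjugate under `Gal(L/K)`, with `∑ i, a i * θ i = 0`. -/
def HasGaloisConjugateRelation.{u} {K : Type u} [Field K] {r : ℕ} (a : Fin r → K) : Prop :=
  ∃ (L : Type u) (_ : Field L) (_ : Algebra K L), FiniteDimensional K L ∧ IsGalois K L ∧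
    ∃ θ : Fin r → L,
      (∀ i, θ i ≠ 0) ∧
      (∀ i j, ∃ σ : L ≃ₐ[K] L, σ (θ i) = θ j) ∧
      ∑ i, algebraMap K L (a i) * θ i = 0

/-- There is a probability distribution on `K ^ r`, other than the point mass at the origin,
supported on a finite subset of the hyperplane `∑ i, a i * x i = 0`, whose one-dimensional
marginals are all equal. -/
def HasBalancedDistribution {K : Type*} [Field K] {r : ℕ} (a : Fin r → K) : Prop :=
  ∃ X : PMF (Fin r → K),
    X ≠ PMF.pure 0 ∧
    X.support.Finite ∧
    X.support ⊆ {x | ∑ i, a i * x i = 0} ∧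
    ∀ i j, X.map (fun x => x i) = X.map (fun x => x j)

/-- For some `N` there are permutation matrices `Π 0, …, Π (r - 1)` of size `N` with
`det (∑ i, a i • Π i) = 0`. (For `N = 0` the determinant is `1`, so `N` is positive.) -/
def HasSingularPermutationCombination {K : Type*} [Field K] {r : ℕ} (a : Fin r → K) : Prop :=
  ∃ (N : ℕ) (P : Fin r → Equiv.Perm (Fin N)),
    (∑ i, a i • (P i).permMatrix K).det = 0

/-!
For the permutation matrices `Π i` of `P i`, `∑ i, a i • Π i` is singular iff some nonzero `v` on
a finite set satisfies `∑ i, a i * v (P i x) = 0` for all `x`. Conjugates `θ i = σ i θ` give such a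
function `g ↦ g θ` on the Galois group, after composition with a linear functional, and evaluating
`v` along the permutations at a uniformly random point gives a balanced distribution. Conversely,
equality of the marginals of a balanced distribution is a system of rational linear equations
between its finitely many weights, so it has a solution in positive integers as well; repeating each
point of the support that many times turns the coordinates into functions which differ by
permutations.

To return to conjugates, it suffices that every symmetric group is a subquotient of a Galois group
over `K`: the kernel vector then lifts to a function on the Galois group, whose values are the
coordinates of `θ` in a normal basis. Over a global field, fix an odd prime `ℓ` and two primes of
`K`, and use the Chinese remainder theorem to find a monic polynomial of degree `ℓ` that is
irreducible modulo the first prime and a product of irreducible factors of degrees `2` and `ℓ - 2`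
modulo the second. It is irreducible over `K`, and the power `ℓ - 2` of a Frobenius element at the
second prime is a transposition of its roots, so its Galois group is the full symmetric group.
-/

section PermutationCombination

variable {K : Type*} [Field K] {r : ℕ} {a : Fin r → K}

theorem sum_smul_permMatrix_mulVec {ι R α : Type*} [Fintype ι] [CommRing R] [Fintype α]
    [DecidableEq α] (a : ι → R) (P : ι → Equiv.Perm α) (v : α → R) (x : α) :
    ((∑ i, a i • (P i).permMatrix R).mulVec v) x = ∑ i, a i * v (P i x) := by
  simp [Matrix.sum_mulVec, Matrix.smul_mulVec, Matrix.permMatrix_mulVec]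

theorem hasSingularPermutationCombination_iff_exists_ne_zero :
    HasSingularPermutationCombination a ↔
      ∃ (N : ℕ) (P : Fin r → Equiv.Perm (Fin N)) (v : Fin N → K),
        v ≠ 0 ∧ ∀ n, ∑ i, a i * v (P i n) = 0 := by
  simp only [HasSingularPermutationCombination, ← Matrix.exists_mulVec_eq_zero_iff, funext_iff,
    sum_smul_permMatrix_mulVec, Pi.zero_apply]

theorem HasSingularPermutationCombination.of_forall_sum_smul_eq_zero {V α : Type*}
    [AddCommGroup V] [Module K V] [Finite α] (P : Fin r → Equiv.Perm α) {v : α → V} (hv : v ≠ 0)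
    (h : ∀ x, ∑ i, a i • v (P i x) = 0) : HasSingularPermutationCombination a := by
  obtain ⟨x, hx⟩ := Function.ne_iff.mp hv
  obtain ⟨ψ, hψ⟩ := Module.Projective.exists_dual_ne_zero K hx
  let e := Finite.equivFin α
  refine hasSingularPermutationCombination_iff_exists_ne_zero.mpr
    ⟨Nat.card α, fun i => e.permCongr (P i), fun n => ψ (v (e.symm n)),
      Function.ne_iff.mpr ⟨e x, by simpa using hψ⟩, fun n => ?_⟩
  simpa using congrArg ψ (h (e.symm n))

theorem HasGaloisConjugateRelation.hasSingularPermutationCombination (hr : 1 ≤ r)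
    (h : HasGaloisConjugateRelation a) : HasSingularPermutationCombination a := by
  obtain ⟨L, _, _, _, _, θ, hθ, hconj, hsum⟩ := h
  choose σ hσ using hconj ⟨0, hr⟩
  refine .of_forall_sum_smul_eq_zero (fun i => Equiv.mulRight (σ i))
    (v := fun g : Gal(L/K) => g (θ ⟨0, hr⟩)) ?_ fun g => ?_
  · exact Function.ne_iff.mpr ⟨1, hθ _⟩
  · simpa [hσ, Algebra.smul_def] using congrArg g hsum

theorem map_perm_uniformOfFintype {α : Type*} [Fintype α] [Nonempty α] (e : Equiv.Perm α) :
    (PMF.uniformOfFintype α).map e = PMF.uniformOfFintype α := by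
  ext x
  rw [PMF.map_apply, tsum_eq_single (e.symm x)]
  · simp
  · exact fun y hy => if_neg fun hxy => hy (by simp [hxy])

theorem HasSingularPermutationCombination.hasBalancedDistribution (hr : 1 ≤ r)
    (h : HasSingularPermutationCombination a) : HasBalancedDistribution a := by
  obtain ⟨N, P, v, hv, h⟩ := hasSingularPermutationCombination_iff_exists_ne_zero.mp h
  obtain ⟨n, hn⟩ := Function.ne_iff.mp hv
  have : Nonempty (Fin N) := ⟨n⟩
  let X : PMF (Fin r → K) := (PMF.uniformOfFintype (Fin N)).map fun n i => v (P i n)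
  have hmarginal i : X.map (fun x => x i) = (PMF.uniformOfFintype (Fin N)).map v := calc
    X.map (fun x => x i) = ((PMF.uniformOfFintype (Fin N)).map (P i)).map v := by
      simp only [X, PMF.map_comp]; rfl
    _ = (PMF.uniformOfFintype (Fin N)).map v := by rw [map_perm_uniformOfFintype]
  have hsupport : X.support = Set.range fun n i => v (P i n) := by
    simp [X, PMF.support_map]
  refine ⟨X, fun hX => hn ?_, ?_, ?_, fun i j => by rw [hmarginal, hmarginal]⟩
  · have hmem : (fun i => v (P i ((P ⟨0, hr⟩).symm n))) ∈ X.support := hsupport ▸ ⟨_, rfl⟩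
    rw [hX, PMF.support_pure, Set.mem_singleton_iff] at hmem
    simpa using congrFun hmem ⟨0, hr⟩
  · exact hsupport ▸ Set.finite_range _
  · exact hsupport ▸ Set.range_subset_iff.mpr h

end PermutationCombination

section Multiplicities

theorem mem_closure_range_dual_rat {V : Type*} [AddCommGroup V] [Module ℚ V] (f : V →ₗ[ℚ] ℝ) :
    ⇑f ∈ closure (Set.range fun (φ : Module.Dual ℚ V) x => (φ x : ℝ)) := by
  let b := Module.Basis.ofVectorSpace ℚ V
  let T (y : Module.Basis.ofVectorSpaceIndex ℚ V → ℝ) (x : V) : ℝ :=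
    (b.repr x).sum fun j c => c * y j
  have hT : Continuous T := continuous_pi fun x =>
    continuous_finsetSum _ fun j _ => continuous_const.mul (continuous_apply j)
  have hf : T (f ∘ b) = f := funext fun x => by
    conv_rhs => rw [← b.linearCombination_repr x, Finsupp.linearCombination_apply, map_finsuppSum]
    simp [T, Rat.smul_def]
  have hmaps : Set.MapsTo T (Set.range (Pi.map fun _ (q : ℚ) => (q : ℝ)))
      (Set.range fun (φ : Module.Dual ℚ V) x => (φ x : ℝ)) := by
    rintro _ ⟨q, rfl⟩
    exact ⟨b.constr ℚ q, funext fun x => by simp [T, b.constr_apply, Finsupp.sum]⟩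
  exact hf ▸ map_mem_closure hT ((DenseRange.piMap fun _ => Rat.denseRange_cast) _) hmaps

theorem exists_dual_rat_pos {ι : Type*} [Finite ι] {w : ι → ℝ} (hw : ∀ i, 0 < w i) :
    ∃ φ : Module.Dual ℚ ℝ, ∀ i, 0 < φ (w i) := by
  have hopen : IsOpen {g : ℝ → ℝ | ∀ i, 0 < g (w i)} := by
    simp only [Set.ofPred_forall]
    exact isOpen_iInter_of_finite fun i => isOpen_lt continuous_const (continuous_apply _)
  obtain ⟨_, hφ, φ, rfl⟩ := mem_closure_iff.mp (mem_closure_range_dual_rat .id) _ hopen hw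
  exact ⟨φ, fun i => Rat.cast_pos.mp (hφ i)⟩

theorem exists_nat_pos_forall_sum_eq_sum {α : Type*} [Finite α] {w : α → ℝ} (hw : ∀ x, 0 < w x) :
    ∃ m : α → ℕ, (∀ x, 0 < m x) ∧
      ∀ s t : Finset α, ∑ x ∈ s, w x = ∑ x ∈ t, w x → ∑ x ∈ s, m x = ∑ x ∈ t, m x := by
  obtain ⟨φ, hφ⟩ := exists_dual_rat_pos hw
  obtain ⟨d, hd⟩ := IsLocalization.exist_integer_multiples_of_finite
    (nonZeroDivisors ℤ) fun x => φ (w x)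
  choose z hz using hd
  have hm x : ((z x).natAbs : ℚ) = |(d : ℚ)| * φ (w x) := by
    have hz : (z x : ℚ) = d * φ (w x) := by simpa using hz x
    rw [Nat.cast_natAbs, Int.cast_abs, hz, abs_mul, abs_of_pos (hφ x)]
  have hd0 : 0 < |(d : ℚ)| := by simp
  refine ⟨fun x => (z x).natAbs, fun x => ?_, fun s t hst => ?_⟩
  · exact_mod_cast (hm x).symm ▸ mul_pos hd0 (hφ x)
  · have := congrArg φ hst
    simp only [map_sum] at this
    exact_mod_cast (by simp [hm, ← Finset.mul_sum, this] :
      ∑ x ∈ s, ((z x).natAbs : ℚ) = ∑ x ∈ t, ((z x).natAbs : ℚ))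

theorem exists_perm_comp_eq_of_card_fiber_eq {β γ : Type*} [Finite β] {f g : β → γ}
    (h : ∀ c, Nat.card {s // f s = c} = Nat.card {s // g s = c}) :
    ∃ e : Equiv.Perm β, ∀ s, g (e s) = f s :=
  have e c : {s // f s = c} ≃ {s // g s = c} := (Finite.card_eq.mp (h c)).some
  ⟨Equiv.ofFiberEquiv e, Equiv.ofFiberEquiv_map e⟩

theorem card_fiber_sigma_fin {α γ : Type*} [Fintype α] [DecidableEq γ] (m : α → ℕ) (f : α → γ)
    (c : γ) : Nat.card {s : Σ x, Fin (m x) // f s.1 = c} = ∑ x with f x = c, m x := by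
  rw [Nat.card_congr (Equiv.subtypeSigmaEquiv _ fun x => f x = c), Nat.card_sigma,
    ← Finset.sum_subtype_eq_sum_filter, Finset.subtype_univ]
  simp only [Nat.card_eq_fintype_card, Fintype.card_fin]

theorem toReal_map_apply_eq_sum {β γ : Type*} [DecidableEq γ] (X : PMF β) [Fintype X.support]
    (f : β → γ) (c : γ) :
    (X.map f c).toReal = ∑ x : X.support with f x.1 = c, (X x).toReal := by
  have hmap : X.map f c = ∑' x, if f x = c then X x else 0 := by
    simp only [PMF.map_apply, eq_comm (a := c)]
  have hsupport : Function.support (fun x => if f x = c then X x else 0) ⊆ X.support :=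
    fun x => by simp
  rw [hmap, ← tsum_subtype_eq_of_support_subset hsupport, tsum_fintype, ← Finset.sum_filter,
    ENNReal.toReal_sum fun x _ => X.apply_ne_top x.1]

theorem exists_mem_support_ne_of_ne_pure {β : Type*} {X : PMF β} {b : β} (hX : X ≠ PMF.pure b) :
    ∃ x ∈ X.support, x ≠ b := by
  contrapose! hX
  have hb : X b = 1 := X.apply_eq_one_iff b |>.mpr
    (X.support_nonempty.subset_singleton_iff.mp hX)
  ext x
  by_cases hx : x = b
  · simp [hx, hb]
  · rw [PMF.pure_apply_of_ne _ _ hx, (X.apply_eq_zero_iff x).mpr (mt (hX x) hx)]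

variable {K : Type*} [Field K] {r : ℕ} {a : Fin r → K}

theorem HasBalancedDistribution.hasSingularPermutationCombination (hr : 1 ≤ r)
    (h : HasBalancedDistribution a) : HasSingularPermutationCombination a := by
  classical
  obtain ⟨X, hX, hfin, hsupport, hmarginal⟩ := h
  have : Fintype X.support := hfin.fintype
  obtain ⟨m, hm, hsum⟩ := exists_nat_pos_forall_sum_eq_sum (w := fun x : X.support => (X x).toReal)
    fun x => ENNReal.toReal_pos x.2 (X.apply_ne_top _)
  let i₀ : Fin r := ⟨0, hr⟩
  let f i (s : Σ x : X.support, Fin (m x)) : K := s.1.1 i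
  have hfiber i c : Nat.card {s // f i s = c} = Nat.card {s // f i₀ s = c} := by
    rw [card_fiber_sigma_fin m (fun x : X.support => x.1 i) c,
      card_fiber_sigma_fin m (fun x : X.support => x.1 i₀) c]
    apply hsum
    rw [← toReal_map_apply_eq_sum X (· i), ← toReal_map_apply_eq_sum X (· i₀), hmarginal i i₀]
  choose P hP using fun i => exists_perm_comp_eq_of_card_fiber_eq (hfiber i)
  obtain ⟨x, hx, hx0⟩ := exists_mem_support_ne_of_ne_pure hX
  obtain ⟨i, hi⟩ := Function.ne_iff.mp hx0
  let s : Σ x : X.support, Fin (m x) := ⟨⟨x, hx⟩, 0, hm _⟩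
  refine .of_forall_sum_smul_eq_zero P (v := f i₀)
    (Function.ne_iff.mpr ⟨P i s, (hP i s).trans_ne hi⟩) fun t => ?_
  simpa only [hP, smul_eq_mul] using! hsupport t.1.2

end Multiplicities

section NormalBasis

theorem algEquiv_sum_smul_normalBasis {K L : Type*} [Field K] [Field L] [Algebra K L]
    [FiniteDimensional K L] [IsGalois K L] (σ : Gal(L/K)) (u : Gal(L/K) → K) :
    σ (∑ g, u g • IsGalois.normalBasis K L g) =
      ∑ g, u (σ⁻¹ * g) • IsGalois.normalBasis K L g := by
  have hσ g : σ (IsGalois.normalBasis K L g) = IsGalois.normalBasis K L (σ * g) := by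
    rw [IsGalois.normalBasis_apply g, IsGalois.normalBasis_apply (σ * g), AlgEquiv.mul_apply]
  rw [map_sum, ← Equiv.sum_comp (Equiv.mulLeft σ) fun g => u (σ⁻¹ * g) • _]
  simp only [map_smul, hσ, Equiv.coe_mulLeft, inv_mul_cancel_left]

theorem HasGaloisConjugateRelation.of_forall_sum_mul_eq_zero.{u} {K L : Type u} [Field K]
    [Field L] [Algebra K L] [FiniteDimensional K L] [IsGalois K L] {r : ℕ} {a : Fin r → K}
    (σ : Fin r → Gal(L/K)) {u : Gal(L/K) → K} (hu : u ≠ 0)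
    (h : ∀ g, ∑ i, a i * u (σ i * g) = 0) : HasGaloisConjugateRelation a := by
  let b := IsGalois.normalBasis K L
  let θ : L := ∑ g, u g • b g
  have hθ : θ ≠ 0 := fun h0 =>
    hu (funext (Fintype.linearIndependent_iff.mp b.linearIndependent u h0))
  refine ⟨L, _, _, ‹_›, ‹_›, fun i => (σ i)⁻¹ θ, fun i => (map_ne_zero _).mpr hθ,
    fun i j => ⟨(σ j)⁻¹ * σ i, by simp⟩, ?_⟩
  calc ∑ i, algebraMap K L (a i) * (σ i)⁻¹ θ
      = ∑ i, ∑ g, (a i * u (σ i * g)) • b g := by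
        simp only [θ, b, algEquiv_sum_smul_normalBasis, inv_inv, ← Algebra.smul_def,
          Finset.smul_sum, smul_smul]
    _ = ∑ g, (∑ i, a i * u (σ i * g)) • b g := by
        rw [Finset.sum_comm]
        simp only [Finset.sum_smul]
    _ = 0 := by simp only [h, zero_smul, Finset.sum_const_zero]

end NormalBasis

/-- Every finite symmetric group is a subquotient of the Galois group of some finite Galois
extension of `K`, so that permutation matrices act inside a normal basis representation. As in
`HasGaloisConjugateRelation`, the extension lives in the universe of `K`. -/
def HasSymmetricGaloisSubquotients.{u} (K : Type u) [Field K] : Prop :=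
  ∀ n : ℕ, ∃ (L : Type u) (_ : Field L) (_ : Algebra K L), FiniteDimensional K L ∧ IsGalois K L ∧
    ∃ (H : Subgroup Gal(L/K)) (φ : H →* Equiv.Perm (Fin n)), Function.Surjective φ

theorem HasSymmetricGaloisSubquotients.hasGaloisConjugateRelation {K : Type*} [Field K]
    (hK : HasSymmetricGaloisSubquotients K) {r : ℕ} {a : Fin r → K}
    (h : HasSingularPermutationCombination a) : HasGaloisConjugateRelation a := by
  classical
  obtain ⟨N, P, v, hv, h⟩ := hasSingularPermutationCombination_iff_exists_ne_zero.mp h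
  obtain ⟨n, hn⟩ := Function.ne_iff.mp hv
  obtain ⟨L, _, _, _, _, H, φ, hφ⟩ := hK N
  choose σ hσ using fun i => hφ (P i)
  let u (g : Gal(L/K)) : K := if hg : g ∈ H then v (φ ⟨g, hg⟩ n) else 0
  have hu1 : u 1 = v n := by
    rw [← Equiv.Perm.one_apply n, ← map_one φ]
    exact dif_pos H.one_mem
  refine .of_forall_sum_mul_eq_zero (fun i => (σ i : Gal(L/K))) (u := u)
    (Function.ne_iff.mpr ⟨1, hu1 ▸ hn⟩) fun g => ?_
  by_cases hg : g ∈ H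
  · have hu i : u (σ i * g) = v (P i (φ ⟨g, hg⟩ n)) := by
      rw [← hσ, ← Equiv.Perm.mul_apply, ← map_mul]
      exact dif_pos (mul_mem (σ i).2 hg)
    simp only [hu, h]
  · have hu i : u (σ i * g) = 0 := dif_neg (by rwa [Subgroup.mul_mem_cancel_left _ (σ i).2])
    simp only [hu, mul_zero, Finset.sum_const_zero]

open Polynomial

section FiniteField

variable {k κ : Type*} [Field k] [Finite k] [CommRing κ] [IsDomain κ] [Algebra k κ]

variable (k) in
theorem exists_monic_irreducible_natDegree_eq {n : ℕ} (hn : n ≠ 0) :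
    ∃ f : k[X], f.Monic ∧ Irreducible f ∧ f.natDegree = n := by
  obtain ⟨p, hp⟩ := CharP.exists k
  have : Fact p.Prime := ⟨CharP.char_is_prime k p⟩
  have : NeZero n := ⟨hn⟩
  obtain ⟨x, hx⟩ := Field.exists_primitive_element k (FiniteField.Extension k p n)
  have hi : IsIntegral k x := .of_finite k x
  refine ⟨minpoly k x, minpoly.monic hi, minpoly.irreducible hi, ?_⟩
  exact ((Field.primitive_element_iff_minpoly_natDegree_eq k x).mp hx).trans
    (FiniteField.finrank_extension k p n)

theorem pow_card_pow_eq_self_iff {f : k[X]} (hf : Irreducible f) {x : κ} (hx : aeval x f = 0)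
    (n : ℕ) : x ^ Nat.card k ^ n = x ↔ f.natDegree ∣ n := by
  rw [hf.natDegree_dvd_iff_dvd_X_pow_card_pow_sub_X, ← hf.dvd_iff_aeval_eq_zero hx]
  simp [sub_eq_zero]

theorem apply_perm_pow_eq_pow_pow {Ω M : Type*} [Monoid M] {σ : Equiv.Perm Ω} {ρ : Ω → M} {q : ℕ}
    (hσ : ∀ ω, ρ (σ ω) = ρ ω ^ q) (n : ℕ) (ω : Ω) : ρ ((σ ^ n) ω) = ρ ω ^ q ^ n := by
  induction n with
  | zero => simp
  | succ n ih => rw [pow_succ', Equiv.Perm.mul_apply, hσ, ih, ← pow_mul, pow_succ]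

theorem card_le_natDegree_of_forall_aeval_eq_zero {A B Ω : Type*} [CommRing A] [CommRing B]
    [IsDomain B] [Algebra A B] [FaithfulSMul A B] {ρ : Ω → B} (hρ : Function.Injective ρ)
    {f : A[X]} (hf : f ≠ 0) {s : Finset Ω} (hs : ∀ ω ∈ s, aeval (ρ ω) f = 0) :
    s.card ≤ f.natDegree := by
  classical
  have hsub : s.map ⟨ρ, hρ⟩ ⊆ (f.aroots B).toFinset := fun x hx => by
    obtain ⟨ω, hω, rfl⟩ := Finset.mem_map.mp hx
    have hf' := (Polynomial.map_ne_zero_iff (FaithfulSMul.algebraMap_injective A B)).mpr hf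
    exact Multiset.mem_toFinset.mpr (mem_aroots'.mpr ⟨hf', hs ω hω⟩)
  calc s.card = (s.map ⟨ρ, hρ⟩).card := (Finset.card_map _).symm
    _ ≤ (f.aroots B).card := (Finset.card_le_card hsub).trans (Multiset.toFinset_card_le _)
    _ ≤ f.natDegree := (card_roots' _).trans natDegree_map_le

/-- The power kills the Frobenius action on the roots of `h` and, its exponent being odd, keeps the
two roots of `g` moving. -/
theorem isSwap_pow_natDegree_of_frobenius {Ω : Type*} [Finite Ω] [DecidableEq Ω]
    {σ : Equiv.Perm Ω} {ρ : Ω → κ} (hρ : Function.Injective ρ)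
    (hσ : ∀ ω, ρ (σ ω) = ρ ω ^ Nat.card k) {g h : k[X]} (hg : Irreducible g) (hh : Irreducible h)
    (hg2 : g.natDegree = 2) (hodd : Odd h.natDegree) (hroot : ∀ ω, aeval (ρ ω) (g * h) = 0)
    (hcard : h.natDegree < Nat.card Ω) : (σ ^ h.natDegree).IsSwap := by
  have := Fintype.ofFinite Ω
  have hor ω : aeval (ρ ω) g = 0 ∨ aeval (ρ ω) h = 0 := by simpa using hroot ω
  have hfix ω (hω : aeval (ρ ω) h = 0) : (σ ^ h.natDegree) ω = ω := hρ <| by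
    rw [apply_perm_pow_eq_pow_pow hσ, (pow_card_pow_eq_self_iff hh hω _).mpr dvd_rfl]
  have hmove ω (hω : aeval (ρ ω) g = 0) : (σ ^ h.natDegree) ω ≠ ω := fun h0 => by
    have hdvd := (pow_card_pow_eq_self_iff hg hω h.natDegree).mp
      (by rw [← apply_perm_pow_eq_pow_pow hσ, h0])
    exact Nat.not_even_iff_odd.mpr hodd (even_iff_two_dvd.mpr (hg2 ▸ hdvd))
  have hle : (σ ^ h.natDegree).support.card ≤ 2 :=
    hg2 ▸ card_le_natDegree_of_forall_aeval_eq_zero hρ hg.ne_zero fun ω hω =>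
      (hor ω).resolve_right fun h0 => Equiv.Perm.mem_support.mp hω (hfix ω h0)
  have hne : σ ^ h.natDegree ≠ 1 := fun h0 => by
    refine hcard.not_ge (Nat.card_eq_fintype_card (α := Ω) ▸ Finset.card_univ (α := Ω) ▸
      card_le_natDegree_of_forall_aeval_eq_zero hρ hh.ne_zero fun ω _ => ?_)
    exact (hor ω).resolve_left fun hω => hmove ω hω (by simp [h0])
  exact Equiv.Perm.card_support_eq_two.mp
    (hle.antisymm (Equiv.Perm.two_le_card_support_of_ne_one hne))

theorem separable_mul_of_natDegree_eq_two_of_odd {F : Type*} [Field F] [PerfectField F]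
    {g h : F[X]} (hg : Irreducible g) (hh : Irreducible h) (hg2 : g.natDegree = 2)
    (hodd : Odd h.natDegree) : (g * h).Separable := by
  refine (PerfectField.separable_of_irreducible hg).mul (PerfectField.separable_of_irreducible hh)
    (hg.coprime_iff_not_dvd.mpr fun hdvd => ?_)
  have hdeg : g.natDegree = h.natDegree :=
    natDegree_eq_of_degree_eq (degree_eq_degree_of_associated (hg.associated_of_dvd hh hdvd))
  exact absurd (hg2 ▸ hdeg ▸ hodd) (by decide : ¬ Odd 2)

end FiniteField

theorem exists_monic_map_mk_eq_of_isCoprime {R : Type*} [CommRing R] {I J : Ideal R}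
    (hIJ : IsCoprime I J) {f : (R ⧸ I)[X]} {g : (R ⧸ J)[X]} (hf : f.Monic) (hg : g.Monic)
    (hdeg : f.natDegree = g.natDegree) : ∃ F : R[X], F.Monic ∧
      F.map (Ideal.Quotient.mk I) = f ∧ F.map (Ideal.Quotient.mk J) = g := by
  choose c hc using fun n =>
    (Ideal.quotientInfEquivQuotientProd I J hIJ).surjective.comp Ideal.Quotient.mk_surjective
      (f.coeff n, g.coeff n)
  have hcI n : Ideal.Quotient.mk I (c n) = f.coeff n := congrArg Prod.fst (hc n)
  have hcJ n : Ideal.Quotient.mk J (c n) = g.coeff n := congrArg Prod.snd (hc n)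
  refine ⟨X ^ f.natDegree + ∑ i ∈ Finset.range f.natDegree, C (c i) * X ^ i,
    monic_X_pow_add ?_, ?_, ?_⟩
  · rw [← Fin.sum_univ_eq_sum_range fun i => C (c i) * X ^ i]
    exact degree_sum_fin_lt _
  · conv_rhs => rw [hf.as_sum]
    simp [Polynomial.map_sum, hcI]
  · conv_rhs => rw [hg.as_sum]
    simp [Polynomial.map_sum, hcJ, hdeg]

theorem finite_quotient_of_forall_exists_monic {A B : Type*} [CommRing A] [CommRing B]
    [Algebra A B] (d : ℕ)
    (h : ∀ b : B, ∃ f : A[X], f.Monic ∧ f.natDegree ≤ d ∧ aeval b f = 0) (p : Ideal A)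
    [Finite (A ⧸ p)] (Q : Ideal B) [Q.IsPrime] [Q.LiesOver p] : Finite (B ⧸ Q) := by
  classical
  refine Set.finite_univ_iff.mp ((bUnion_roots_finite (algebraMap (A ⧸ p) (B ⧸ Q)) d
    Set.finite_univ).subset fun x _ => ?_)
  obtain ⟨b, rfl⟩ := Ideal.Quotient.mk_surjective x
  obtain ⟨f, hf, hd, hb⟩ := h b
  have hroot : aeval (Ideal.Quotient.mk Q b) (f.map (algebraMap A (A ⧸ p))) = 0 := by
    rw [aeval_map_algebraMap, ← Ideal.Quotient.algebraMap_eq, aeval_algebraMap_apply, hb, map_zero]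
  have hne : (f.map (algebraMap A (A ⧸ p))).map (algebraMap (A ⧸ p) (B ⧸ Q)) ≠ 0 :=
    ((hf.map _).map _).ne_zero
  simp only [Set.mem_iUnion]
  exact ⟨f.map (algebraMap A (A ⧸ p)), ⟨natDegree_map_le.trans hd, fun _ => trivial⟩,
    Multiset.mem_toFinset.mpr ((mem_roots hne).mpr ((eval_map_algebraMap _ _).trans hroot))⟩

theorem finite_quotient_of_finiteDimensional {A R : Type*} (k K : Type*) [CommRing A]
    [IsDomain A] [IsIntegrallyClosed A] [Field k] [Algebra A k] [IsFractionRing A k] [CommRing R]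
    [Algebra A R] [Field K] [Algebra R K] [FaithfulSMul R K] [Algebra k K] [Algebra A K]
    [IsScalarTower A k K] [IsScalarTower A R K] [FiniteDimensional k K] [Algebra.IsIntegral A R]
    (p : Ideal A) [Finite (A ⧸ p)] (Q : Ideal R) [Q.IsPrime] [Q.LiesOver p] :
    Finite (R ⧸ Q) := by
  refine finite_quotient_of_forall_exists_monic (Module.finrank k K) (fun b => ?_) p Q
  have hb := Algebra.IsIntegral.isIntegral (R := A) b
  have hbK : IsIntegral A (algebraMap R K b) := hb.algebraMap
  refine ⟨minpoly A (algebraMap R K b), minpoly.monic hbK, ?_,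
    FaithfulSMul.algebraMap_injective R K ?_⟩
  · rw [← (minpoly.monic hbK).natDegree_map (algebraMap A k),
      ← minpoly.isIntegrallyClosed_eq_field_fractions' k hbK]
    exact minpoly.natDegree_le _
  · rw [← aeval_algebraMap_apply, minpoly.aeval, map_zero]

theorem toPermHom_surjective_of_isSwap {G Ω : Type*} [Group G] [MulAction G Ω] [DecidableEq Ω]
    [MulAction.IsPretransitive G Ω] (hprime : (Nat.card Ω).Prime) {σ : G}
    (hσ : (MulAction.toPermHom G Ω σ).IsSwap) : Function.Surjective (MulAction.toPermHom G Ω) := by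
  have : Finite Ω := Nat.finite_of_card_ne_zero hprime.ne_zero
  have : MulAction.IsPretransitive (MulAction.toPermHom G Ω).range Ω := ⟨fun x y =>
    (MulAction.exists_smul_eq G x y).elim fun g hg => ⟨⟨_, g, rfl⟩, hg⟩⟩
  exact MonoidHom.range_eq_top.mp <| Equiv.Perm.subgroup_eq_top_of_isPreprimitive_of_isSwap_mem
    (.of_prime_card hprime) _ hσ ⟨σ, rfl⟩

theorem nodup_map_roots_of_separable_map {S κ : Type*} [CommRing S] [IsDomain S] [CommRing κ]
    [IsDomain κ] (ρ : S →+* κ) {f : S[X]} (hf : f.Splits) (hsep : (f.map ρ).Separable) :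
    (f.roots.map ρ).Nodup :=
  hf.roots_map_of_ne_zero hsep.ne_zero ▸ nodup_roots hsep

section ReductionOfRoots

variable {R S : Type*} [CommRing R] [CommRing S] [IsDomain S] [Algebra R S]
  (P : Ideal R) {F : R[X]}

theorem nodup_map_mk_aroots (Q : Ideal S) [Q.IsPrime] [Q.LiesOver P]
    (hsplit : (F.map (algebraMap R S)).Splits) (hsep : (F.map (Ideal.Quotient.mk P)).Separable) :
    ((F.aroots S).map (Ideal.Quotient.mk Q)).Nodup := by
  refine nodup_map_roots_of_separable_map _ hsplit ?_
  have hmap : (F.map (algebraMap R S)).map (Ideal.Quotient.mk Q) =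
      (F.map (Ideal.Quotient.mk P)).map (algebraMap (R ⧸ P) (S ⧸ Q)) := by
    rw [map_map, map_map]
    rfl
  exact hmap ▸ hsep.map

theorem natCard_rootSet_eq_natDegree (Q : Ideal S) [Q.IsPrime] [Q.LiesOver P]
    (hsplit : (F.map (algebraMap R S)).Splits) (hsep : (F.map (Ideal.Quotient.mk P)).Separable)
    (hF : F.Monic) : Nat.card (F.rootSet S) = F.natDegree := by
  classical
  have hnodup := (nodup_map_mk_aroots P Q hsplit hsep).of_map
  rw [rootSet_def, Nat.card_coe_set_eq, Set.ncard_coe_finset,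
    Multiset.toFinset_card_of_nodup hnodup, aroots, ← hsplit.natDegree_eq_card_roots,
    hF.natDegree_map]

end ReductionOfRoots

section InvariantExtension

variable {R S : Type*} (G : Type*) [CommRing R] [CommRing S] [Algebra R S] [Group G] [Finite G]
  [MulSemiringAction G S] [Algebra.IsInvariant R S G]

theorem exists_smul_eq_of_aeval_eq_zero [IsDomain R] [IsIntegrallyClosed R] [IsDomain S]
    [FaithfulSMul R S] {F : R[X]} (hF : Irreducible F) {x y : S} (hx : aeval x F = 0)
    (hy : aeval y F = 0) : ∃ g : G, g • x = y := by
  have := Fintype.ofFinite G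
  have hint : IsIntegral R x := (Algebra.IsInvariant.isIntegral R S G).isIntegral x
  obtain ⟨M, hM⟩ := (mem_lifts _).mp (Algebra.IsInvariant.charpoly_mem_lifts R S G x)
  have haeval z : aeval z M = ∏ g : G, (z - g • x) := by
    rw [← eval_map_algebraMap, hM, MulSemiringAction.charpoly_eq, eval_prod]
    simp
  have hxM : aeval x M = 0 := haeval x ▸ Finset.prod_eq_zero (Finset.mem_univ 1) (by simp)
  have hFM : F ∣ M := by
    have hmin : minpoly R x ∣ F := minpoly.isIntegrallyClosed_dvd hint hx
    exact ((minpoly.irreducible hint).dvd_symm hF hmin).trans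
      (minpoly.isIntegrallyClosed_dvd hint hxM)
  have hyM : ∏ g : G, (y - g • x) = 0 := haeval y ▸ aeval_eq_zero_of_dvd_aeval_eq_zero hFM hy
  obtain ⟨g, -, hg⟩ := Finset.prod_eq_zero_iff.mp hyM
  exact ⟨g, (sub_eq_zero.mp hg).symm⟩

variable [SMulCommClass G R S] (P : Ideal R) [P.IsMaximal] [Finite (R ⧸ P)]

theorem exists_forall_mk_smul_eq_pow_card (Q : Ideal S) [Q.IsMaximal] [Q.LiesOver P] :
    ∃ σ : G, ∀ x : S, Ideal.Quotient.mk Q (σ • x) = Ideal.Quotient.mk Q x ^ Nat.card (R ⧸ P) := by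
  let _ := Ideal.Quotient.field P
  let _ := Ideal.Quotient.field Q
  have := Algebra.IsInvariant.isIntegral R S G
  have := Ideal.Quotient.finite_of_isInvariant G P Q
  have := Module.finite_of_finite (R ⧸ P) (M := S ⧸ Q)
  obtain ⟨σ, hσ⟩ := IsArithFrobAt.exists_of_isInvariant R G Q
  exact ⟨σ, fun x => Ideal.over_def Q P ▸ hσ.mk_apply x⟩

theorem exists_isSwap_toPermHom_rootSet [IsDomain S] (Q : Ideal S) [Q.IsMaximal]
    [Q.LiesOver P] {F : R[X]} [DecidableEq (F.rootSet S)]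
    (hsplit : (F.map (algebraMap R S)).Splits) (hF : F.Monic) {g h : (R ⧸ P)[X]}
    (hg : Irreducible g) (hh : Irreducible h) (hg2 : g.natDegree = 2) (hodd : Odd h.natDegree)
    (hgh : F.map (Ideal.Quotient.mk P) = g * h) :
    ∃ σ : G, (MulAction.toPermHom G (F.rootSet S) σ).IsSwap := by
  let _ := Ideal.Quotient.field P
  have hsep : (F.map (Ideal.Quotient.mk P)).Separable :=
    hgh ▸ separable_mul_of_natDegree_eq_two_of_odd hg hh hg2 hodd
  obtain ⟨σ, hσ⟩ := exists_forall_mk_smul_eq_pow_card G P Q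
  refine ⟨σ ^ h.natDegree, map_pow (MulAction.toPermHom G (F.rootSet S)) σ _ ▸
    isSwap_pow_natDegree_of_frobenius (ρ := fun ω : F.rootSet S => Ideal.Quotient.mk Q ω) ?_
      (fun ω => hσ ω) hg hh hg2 hodd (fun ω => ?_) ?_⟩
  · exact fun ω ω' h => Subtype.ext <| Multiset.inj_on_of_nodup_map
      (nodup_map_mk_aroots P Q hsplit hsep) _ (mem_aroots'.mpr (mem_rootSet'.mp ω.2)) _
      (mem_aroots'.mpr (mem_rootSet'.mp ω'.2)) h
  · have hFω : aeval (ω : S) F = 0 := aeval_eq_zero_of_mem_rootSet ω.2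
    rw [← hgh, ← Ideal.Quotient.algebraMap_eq P, aeval_map_algebraMap,
      ← Ideal.Quotient.algebraMap_eq Q, aeval_algebraMap_apply, hFω, map_zero]
  · rw [natCard_rootSet_eq_natDegree P Q hsplit hsep hF, ← hF.natDegree_map (Ideal.Quotient.mk P),
      hgh, natDegree_mul hg.ne_zero hh.ne_zero]
    omega

end InvariantExtension

theorem splits_map_of_isIntegralClosure {R S L : Type*} [CommRing R] [CommRing S]
    [CommRing L] [IsDomain L] [Algebra R S] [Algebra S L] [Algebra R L] [IsScalarTower R S L]
    [IsIntegralClosure S R L] {F : R[X]} (hF : F.Monic)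
    (hsplit : (F.map (algebraMap R L)).Splits) : (F.map (algebraMap R S)).Splits := by
  have hmap : (F.map (algebraMap R S)).map (algebraMap S L) = F.map (algebraMap R L) := by
    rw [map_map, ← IsScalarTower.algebraMap_eq]
  refine .of_splits_map_of_injective (IsIntegralClosure.algebraMap_injective S R L)
    (hmap ▸ hsplit) fun x hx => ?_
  rw [hmap, mem_roots (hF.map _).ne_zero, IsRoot, eval_map] at hx
  exact IsIntegralClosure.isIntegral_iff.mp ⟨F, hF, hx⟩

section FractionField

variable {R : Type*} [CommRing R] [IsDomain R]

theorem exists_monic_irreducible_map_mk_eq_mul {P₁ P₂ : Ideal R} [P₁.IsMaximal] [P₂.IsMaximal]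
    (hne : P₁ ≠ P₂) [Finite (R ⧸ P₁)] [Finite (R ⧸ P₂)] {n : ℕ} (hn : 2 < n) (hodd : Odd n) :
    ∃ F : R[X], F.Monic ∧ Irreducible F ∧ F.natDegree = n ∧
      ∃ g h : (R ⧸ P₂)[X], Irreducible g ∧ Irreducible h ∧ g.natDegree = 2 ∧ Odd h.natDegree ∧
        F.map (Ideal.Quotient.mk P₂) = g * h := by
  let _ := Ideal.Quotient.field P₁
  let _ := Ideal.Quotient.field P₂
  obtain ⟨f, hfm, hf, hfd⟩ := exists_monic_irreducible_natDegree_eq (R ⧸ P₁) (n := n) (by omega)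
  obtain ⟨g, hgm, hg, hgd⟩ := exists_monic_irreducible_natDegree_eq (R ⧸ P₂) two_ne_zero
  obtain ⟨h, hhm, hh, hhd⟩ :=
    exists_monic_irreducible_natDegree_eq (R ⧸ P₂) (n := n - 2) (by omega)
  obtain ⟨F, hF, hF₁, hF₂⟩ := exists_monic_map_mk_eq_of_isCoprime
    (Ideal.isCoprime_of_isMaximal hne) hfm (hgm.mul hhm)
    (by rw [hgm.natDegree_mul hhm]; omega)
  refine ⟨F, hF, hF.irreducible_of_irreducible_map _ F (hF₁ ▸ hf), ?_, g, h, hg, hh, hgd, ?_, hF₂⟩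
  · rw [← hF.natDegree_map (Ideal.Quotient.mk P₁), hF₁, hfd]
  · exact hhd ▸ Nat.Odd.sub_even hn.le hodd even_two

variable [IsIntegrallyClosed R] {K L : Type*} [Field K] [Algebra R K] [IsFractionRing R K]
  [Field L] [Algebra K L]

variable (K L) in
theorem exists_gal_surjective_perm_of_splits [FiniteDimensional K L] [IsGalois K L] [Algebra R L]
    [IsScalarTower R K L] {F : R[X]} (hF : F.Monic) (hirr : Irreducible F)
    (hprime : F.natDegree.Prime) (hsplit : (F.map (algebraMap R L)).Splits) {P : Ideal R}
    [P.IsMaximal] [Finite (R ⧸ P)] {g h : (R ⧸ P)[X]} (hg : Irreducible g) (hh : Irreducible h)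
    (hg2 : g.natDegree = 2) (hodd : Odd h.natDegree)
    (hgh : F.map (Ideal.Quotient.mk P) = g * h) :
    ∃ φ : Gal(L/K) →* Equiv.Perm (Fin F.natDegree), Function.Surjective φ := by
  classical
  let S := integralClosure R L
  let _ := IsIntegralClosure.MulSemiringAction R K L S
  have := IsIntegralClosure.isFractionRing_of_finite_extension R K L S
  have := Algebra.isInvariant_of_isGalois R K L S
  have : SMulCommClass Gal(L/K) R S := ⟨fun σ r s => map_smul (galRestrict R K L S σ) r s⟩
  have : FaithfulSMul R L := .trans R K L
  have : FaithfulSMul R S := .tower_bot R S L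
  have hsplitS : (F.map (algebraMap R S)).Splits := splits_map_of_isIntegralClosure hF hsplit
  let _ := Ideal.Quotient.field P
  have hsep : (F.map (Ideal.Quotient.mk P)).Separable :=
    hgh ▸ separable_mul_of_natDegree_eq_two_of_odd hg hh hg2 hodd
  obtain ⟨Q, _, _⟩ := Ideal.exists_maximal_ideal_liesOver_of_isIntegral (S := S) P
  have hcard := natCard_rootSet_eq_natDegree P Q hsplitS hsep hF
  have : MulAction.IsPretransitive Gal(L/K) (F.rootSet S) := ⟨fun ω ω' =>
    (exists_smul_eq_of_aeval_eq_zero Gal(L/K) hirr (aeval_eq_zero_of_mem_rootSet ω.2)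
      (aeval_eq_zero_of_mem_rootSet ω'.2)).imp fun _ => Subtype.ext⟩
  obtain ⟨σ, hσ⟩ := exists_isSwap_toPermHom_rootSet Gal(L/K) P Q hsplitS hF hg hh hg2 hodd hgh
  have e := (Finite.equivFinOfCardEq hcard).permCongrHom
  exact ⟨e.toMonoidHom.comp (MulAction.toPermHom _ _), e.surjective.comp
    (toPermHom_surjective_of_isSwap (hcard.symm ▸ hprime) hσ)⟩

end FractionField

theorem separable_map_of_separable_map_of_not_isUnit {R A K : Type*} [CommRing R] [CommRing A]
    [Field K] {i : R →+* K} (hi : Function.Injective i) {f : R →+* A} {F : R[X]}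
    (hirr : Irreducible (F.map i)) (hsep : (F.map f).Separable) (hunit : ¬ IsUnit (F.map f)) :
    (F.map i).Separable := by
  rw [separable_iff_derivative_ne_zero hirr, derivative_map, Ne, Polynomial.map_eq_zero_iff hi]
  intro hder
  rw [separable_def, derivative_map, hder, Polynomial.map_zero, isCoprime_zero_right] at hsep
  exact hunit hsep

theorem exists_galois_surjective_perm.{u} {R : Type*} {K : Type u} [CommRing R] [IsDomain R]
    [IsIntegrallyClosed R] [Field K] [Algebra R K] [IsFractionRing R K] {P₁ P₂ : Ideal R}
    [P₁.IsMaximal] [P₂.IsMaximal] (hne : P₁ ≠ P₂) [Finite (R ⧸ P₁)] [Finite (R ⧸ P₂)] {ℓ : ℕ}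
    (hℓ : ℓ.Prime) (hodd : Odd ℓ) :
    ∃ (L : Type u) (_ : Field L) (_ : Algebra K L), FiniteDimensional K L ∧ IsGalois K L ∧
      ∃ φ : Gal(L/K) →* Equiv.Perm (Fin ℓ), Function.Surjective φ := by
  obtain ⟨F, hF, hirr, rfl, g, h, hg, hh, hg2, hhodd, hgh⟩ :=
    exists_monic_irreducible_map_mk_eq_mul hne
      (hℓ.two_le.lt_of_ne fun hℓ2 => absurd (hℓ2 ▸ hodd) (by decide : ¬ Odd 2)) hodd
  let _ := Ideal.Quotient.field P₂
  let f := F.map (algebraMap R K)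
  have hsep : f.Separable := by
    refine separable_map_of_separable_map_of_not_isUnit (f := Ideal.Quotient.mk P₂)
      (IsFractionRing.injective R K) (hF.irreducible_iff_irreducible_map_fraction_map.mp hirr)
      (hgh ▸ separable_mul_of_natDegree_eq_two_of_odd hg hh hg2 hhodd) fun hunit => ?_
    exact hg.not_isUnit (isUnit_of_mul_isUnit_left (hgh ▸ hunit))
  have hsplit : (F.map (algebraMap R f.SplittingField)).Splits := by
    rw [IsScalarTower.algebraMap_eq R K, ← map_map]
    exact SplittingField.splits f
  have hgal : IsGalois K f.SplittingField := .of_separable_splitting_field hsep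
  exact ⟨f.SplittingField, inferInstance, inferInstance, inferInstance, hgal,
    exists_gal_surjective_perm_of_splits K _ hF hirr hℓ hsplit hg hh hg2 hhodd hgh⟩

theorem exists_subgroup_surjective_of_injective {A B G : Type*} [Group A] [Group B] [Group G]
    {ι : A →* B} (hι : Function.Injective ι) {φ : G →* B} (hφ : Function.Surjective φ) :
    ∃ (H : Subgroup G) (ψ : H →* A), Function.Surjective ψ := by
  let e := MonoidHom.ofInjective hι
  refine ⟨ι.range.comap φ, e.symm.toMonoidHom.comp (φ.subgroupComap ι.range),
    e.symm.surjective.comp ?_⟩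
  exact φ.subgroupComap_surjective_of_surjective ι.range hφ

theorem hasSymmetricGaloisSubquotients_of_isFractionRing (R : Type*) {K : Type*} [CommRing R]
    [IsDomain R] [IsIntegrallyClosed R] [Field K] [Algebra R K] [IsFractionRing R K]
    {P₁ P₂ : Ideal R} [P₁.IsMaximal] [P₂.IsMaximal] (hne : P₁ ≠ P₂) [Finite (R ⧸ P₁)]
    [Finite (R ⧸ P₂)] : HasSymmetricGaloisSubquotients K := by
  intro n
  obtain ⟨ℓ, hnℓ, hℓ⟩ := Nat.exists_infinite_primes (max n 3)
  obtain ⟨L, _, _, hfin, hgal, φ, hφ⟩ :=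
    exists_galois_surjective_perm (K := K) hne hℓ (hℓ.odd_of_ne_two (by omega))
  exact ⟨L, _, _, hfin, hgal, exists_subgroup_surjective_of_injective
    (Equiv.Perm.viaEmbeddingHom_injective (Fin.castLEEmb (le_of_max_le_left hnℓ))) hφ⟩

theorem hasSymmetricGaloisSubquotients_of_finiteDimensional {A : Type*} (k : Type*) {K : Type*}
    [CommRing A] [IsDomain A] [IsIntegrallyClosed A] [Field k] [Algebra A k] [IsFractionRing A k]
    [Field K] [Algebra k K] [Algebra A K] [IsScalarTower A k K] [FiniteDimensional k K]
    {p₁ p₂ : Ideal A} [p₁.IsMaximal] [p₂.IsMaximal] (hne : p₁ ≠ p₂) [Finite (A ⧸ p₁)]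
    [Finite (A ⧸ p₂)] : HasSymmetricGaloisSubquotients K := by
  let R := integralClosure A K
  have : IsFractionRing R K := integralClosure.isFractionRing_of_finite_extension k K
  have : IsIntegrallyClosed R := integralClosure.isIntegrallyClosedOfFiniteExtension k
  have : FaithfulSMul A K := .trans A k K
  obtain ⟨P₁, _, _⟩ := Ideal.exists_maximal_ideal_liesOver_of_isIntegral (S := R) p₁
  obtain ⟨P₂, _, _⟩ := Ideal.exists_maximal_ideal_liesOver_of_isIntegral (S := R) p₂
  have hP : P₁ ≠ P₂ := by
    rintro rfl
    exact hne ((Ideal.over_def P₁ p₁).trans (Ideal.over_def P₁ p₂).symm)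
  have := finite_quotient_of_finiteDimensional k K p₁ P₁
  have := finite_quotient_of_finiteDimensional k K p₂ P₂
  exact hasSymmetricGaloisSubquotients_of_isFractionRing R hP

theorem hasSymmetricGaloisSubquotients_of_numberField (K : Type*) [Field K] [NumberField K] :
    HasSymmetricGaloisSubquotients K := by
  have isMaximal {p : ℕ} (hp : p.Prime) : (Ideal.span {(p : ℤ)}).IsMaximal :=
    PrincipalIdealRing.isMaximal_of_irreducible (Nat.prime_iff_prime_int.mp hp).irreducible
  have finite_quotient {p : ℕ} (hp : p.Prime) : Finite (ℤ ⧸ Ideal.span {(p : ℤ)}) :=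
    have : NeZero p := ⟨hp.ne_zero⟩
    .of_equiv _ (Int.quotientSpanNatEquivZMod p).symm.toEquiv
  have := isMaximal Nat.prime_two
  have := isMaximal Nat.prime_three
  have := finite_quotient Nat.prime_two
  have := finite_quotient Nat.prime_three
  refine hasSymmetricGaloisSubquotients_of_finiteDimensional ℚ
    (p₁ := Ideal.span {((2 : ℕ) : ℤ)}) (p₂ := Ideal.span {((3 : ℕ) : ℤ)}) fun h => ?_
  rw [Ideal.span_singleton_eq_span_singleton, Int.associated_iff_natAbs] at h
  exact absurd h (by decide)

theorem hasSymmetricGaloisSubquotients_of_functionField (F K : Type*) [Field F] [Finite F]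
    [Field K] [Algebra (RatFunc F) K] [FunctionField F K] :
    HasSymmetricGaloisSubquotients K := by
  let _ : Algebra F[X] K :=
    ((algebraMap (RatFunc F) K).comp (algebraMap F[X] (RatFunc F))).toAlgebra
  have : IsScalarTower F[X] (RatFunc F) K := .of_algebraMap_eq fun _ => rfl
  have isMaximal (c : F) : (Ideal.span {X - C c}).IsMaximal :=
    PrincipalIdealRing.isMaximal_of_irreducible (irreducible_X_sub_C c)
  have finite_quotient (c : F) : Finite (F[X] ⧸ Ideal.span {X - C c}) :=
    .of_equiv _ (quotientSpanXSubCAlgEquiv c).symm.toEquiv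
  refine hasSymmetricGaloisSubquotients_of_finiteDimensional (RatFunc F)
    (p₁ := Ideal.span {X - C (0 : F)}) (p₂ := Ideal.span {X - C 1}) fun h => ?_
  have hmem := Ideal.mem_span_singleton_self (X - C (0 : F))
  rw [h, Ideal.mem_span_singleton, dvd_iff_isRoot] at hmem
  simp at hmem

theorem IsGlobalField.hasSymmetricGaloisSubquotients {K : Type*} [Field K]
    (hK : IsGlobalField K) : HasSymmetricGaloisSubquotients K := by
  obtain _ | ⟨F, _, _, _, _⟩ := hK
  · exact hasSymmetricGaloisSubquotients_of_numberField K
  · exact hasSymmetricGaloisSubquotients_of_functionField F K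

theorem mainTheorem3_general {K : Type*} [Field K] (hK : HasSymmetricGaloisSubquotients K) (r : ℕ)
    (hr : 1 ≤ r) (a : Fin r → K) :
    List.TFAE [HasGaloisConjugateRelation a, HasBalancedDistribution a,
      HasSingularPermutationCombination a] := by
  tfae_have 1 → 3 := fun h => h.hasSingularPermutationCombination hr
  tfae_have 3 → 2 := fun h => h.hasBalancedDistribution hr
  tfae_have 2 → 3 := fun h => h.hasSingularPermutationCombination hr
  tfae_have 3 → 1 := hK.hasGaloisConjugateRelation
  tfae_finish

theorem mainTheorem3 {K : Type*} [Field K] (hK : IsGlobalField K) (r : ℕ) (hr : 1 ≤ r)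
    (a : Fin r → K) :
    List.TFAE [HasGaloisConjugateRelation a, HasBalancedDistribution a,
      HasSingularPermutationCombination a] :=
  mainTheorem3_general hK.hasSymmetricGaloisSubquotients r hr a
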